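/- Let $A$ be a reduced Noetherian ring (commutative with one; for instance, a reduced excellent ring), with total ring of fractions $Q(A)$ and normalization $\overline{A}$, the integral closure of $A$ in $Q(A)$. Let $\mathcal C_A=\operatorname{Ann}_A(\overline A/A)$ be its conductor. A \emph{test ideal} for $A$ is a radical ideal $J\subseteq A$ that contains a non-zerodivisor of $A$ and satisfies $V(\mathcal C_A)\subseteq V(J)$. For an ideal $I$ of $A$, write $\operatorname{Ass}(I)$ for the set of associated primes of the $A$-module $A/I$. For a radical ideal $J\subseteq A$ containing a non-zerodivisor, put $A_0=A$, $J_i=\sqrt{JA_i}$ and $A_{i+1}=\operatorname{End}_{A_i}(J_i)$, where $\operatorname{End}_{A_i}(J_i)$ is identified with the subring $\{x\in Q(A)\mid xJ_i\subseteq J_i\}$ of $Q(A)$, and let $n(A,J)\in\mathbb N\cup\{\infty\}$ be the least $n\ge 0$ with $A_n=A_{n+1}$ ($\infty$ if there is none). Suppose that $A$ is equidimensional (that is, $\dim A/\mathfrak p=\dim A$ for all minimal primes $\mathfrak p$ of $A$) and satisfies Serre's condition $(S_2)$ (that is, $\operatorname{depth} A_P\ge\min\{2,\dim A_P\}$ for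 all $P\in\operatorname{Spec}(A)$). Let $J$ be a test ideal for $A$, and let $J'\subseteq A$ be a radical ideal with $\operatorname{Ass}(J')\subseteq\operatorname{Ass}(J)$ (which forces $J\subseteq J'$, so that $J'$ contains a non-zerodivisor). Then \[ n(A,J')\le n(A,J)<\infty . \] -/

import Mathlib

namespace GLS

/-- The conductor `Ann_A(Ā / A)` of `A` in its normalization `Ā`, the integral closure of `A` in
the total ring of fractions of `A`. -/
noncomputable def conductor (A : Type*) [CommRing A] : Ideal A :=
  Module.annihilator A
    (integralClosure A (FractionRing A) ⧸
      LinearMap.range (Algebra.linearMap A (integralClosure A (FractionRing A))))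

/-- Test ideals for `A`. -/
structure IsTestIdeal {A : Type*} [CommRing A] (J : Ideal A) : Prop where
  exists_nonZeroDivisor : ∃ g ∈ J, g ∈ nonZeroDivisors A
  isRadical : J.IsRadical
  zeroLocus_subset :
    PrimeSpectrum.zeroLocus (conductor A : Set A) ⊆ PrimeSpectrum.zeroLocus (J : Set A)

/-- For an `A`-subalgebra `C` of `Q` and an ideal `J` of `C`, the subring of `Q` consisting of
the elements whose multiplication map is a `C`-linear endomorphism of `J`. If `C` lies in the
total ring of fractions `Q` of `A` and `J` contains a non-zerodivisor of `A`, then every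
endomorphism is of this form for exactly one element (`existsUnique_mem_endSubalgebra`),
and this is `End_C(J)` as a subring of `Q`. -/
def endSubalgebra {A Q : Type*} [CommRing A] [CommRing Q] [Algebra A Q]
    (C : Subalgebra A Q) (J : Ideal C) : Subalgebra A Q where
  carrier := {x | ∃ φ : J →ₗ[C] J, ∀ y : J, ((φ y : C) : Q) = x * ((y : C) : Q)}
  mul_mem' := by
    rintro x x' ⟨φ, hφ⟩ ⟨ψ, hψ⟩
    exact ⟨φ ∘ₗ ψ, fun y => by rw [LinearMap.comp_apply, hφ, hψ, mul_assoc]⟩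
  add_mem' := by
    rintro x x' ⟨φ, hφ⟩ ⟨ψ, hψ⟩
    exact ⟨φ + ψ, fun y => by simp [hφ, hψ, add_mul]⟩
  algebraMap_mem' := fun a =>
    ⟨algebraMap A C a • LinearMap.id, fun y => by simp [Algebra.smul_def]⟩

theorem existsUnique_mem_endSubalgebra {A Q : Type*} [CommRing A] [CommRing Q] [Algebra A Q]
    [IsFractionRing A Q] (C : Subalgebra A Q) (J : Ideal C) (g : A) (hg : g ∈ nonZeroDivisors A)
    (hgJ : algebraMap A C g ∈ J) (φ : J →ₗ[C] J) :
    ∃! x : Q, x ∈ endSubalgebra C J ∧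
      ∀ y : J, ((φ y : C) : Q) = x * ((y : C) : Q) := by
  have hu : IsUnit (algebraMap A Q g) :=
    IsLocalization.map_units Q (⟨g, hg⟩ : nonZeroDivisors A)
  obtain ⟨u, hu⟩ := hu
  have hgc : ((algebraMap A C g : C) : Q) = u := by rw [hu]; rfl
  have key : ∀ y : J, ((φ y : C) : Q)
      = (u⁻¹ : Qˣ) * ((φ ⟨_, hgJ⟩ : C) : Q)
        * ((y : C) : Q) := by
    intro y
    have h1 : (algebraMap A C g) • y = (y : C) • (⟨_, hgJ⟩ : J) := by
      ext; simp [Algebra.smul_def, mul_comm]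
    have h2 := congrArg (fun z : J => ((z : C) : Q)) (congrArg φ h1)
    simp only [map_smul, Submodule.coe_smul, smul_eq_mul, MulMemClass.coe_mul, hgc] at h2
    rw [mul_assoc, Units.eq_inv_mul_iff_mul_eq, h2, mul_comm]
  refine ⟨_, ⟨⟨φ, key⟩, key⟩, ?_⟩
  rintro x ⟨-, hx⟩
  have h := hx ⟨_, hgJ⟩
  simp only [hgc] at h
  rw [h, mul_comm x, Units.inv_mul_cancel_left]

/-- The chain `A₀ = A`, `Aᵢ₊₁ = End_{Aᵢ}(√(J Aᵢ))` of subrings of the total ring of fractions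
of `A`. -/
noncomputable def chain {A : Type*} [CommRing A] (J : Ideal A) :
    ℕ → Subalgebra A (FractionRing A)
  | 0 => ⊥
  | i + 1 => endSubalgebra (chain J i) (J.map (algebraMap A (chain J i))).radical

/-- The number `n(A, J)` of steps: the least `n` with `Aₙ = Aₙ₊₁`
(and `⊤` if there is no such `n`). -/
noncomputable def numSteps {A : Type*} [CommRing A] (J : Ideal A) : ℕ∞ :=
  ⨅ n ∈ {n : ℕ | chain J n = chain J (n + 1)}, (n : ℕ∞)

/-- The depth of a local ring: the supremum of the lengths of the regular sequences in its
maximal ideal. -/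
noncomputable def depth (R : Type*) [CommRing R] [IsLocalRing R] : ℕ∞ :=
  ⨆ rs ∈ {rs : List R | (∀ r ∈ rs, r ∈ IsLocalRing.maximalIdeal R) ∧
    RingTheory.Sequence.IsRegular R rs}, (rs.length : ℕ∞)

/-- Serre's condition `(Sᵢ)`. -/
def SerreS (R : Type*) [CommRing R] (i : ℕ) : Prop :=
  ∀ (P : Ideal R) [P.IsPrime],
    min (i : WithBot ℕ∞) (ringKrullDim (Localization.AtPrime P)) ≤
      (depth (Localization.AtPrime P) : WithBot ℕ∞)

/-- All irreducible components of `Spec R` have the same dimension. -/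
def IsEquidimensional (R : Type*) [CommRing R] : Prop :=
  ∀ p ∈ minimalPrimes R, ringKrullDim (R ⧸ p) = ringKrullDim R

end GLS

/-
Every `Aᵢ` is a finite `A`-module inside the integral closure `Ā`, so the chain is stationary as
soon as `Ā` is finite over `A`, which a test ideal guarantees. By lying over, `√(J Aᵢ)` is the
trace on `Aᵢ` of `√(J Ā)`, so that `Aᵢ₊₁` consists of the `x ∈ Ā` with
`x (Aᵢ ∩ √(J Ā)) ⊆ Aᵢ`. This description shows that up to localization at a prime `P` the chain
depends only on `√J` near `P`, and that under `(S₂)` membership of an integral element in `Aᵢ` can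
be tested at the primes of height at most one, since this is so for `A₀ = A`. If `P` is such a prime
and `J` contains a non-zerodivisor, then near `P` the ideal `√J` is `P` or `A`. Hence near `P` the
chain of an ideal `J'` with `J ⊆ √J'` is the chain of `J` or constant, and it stops no later than
the chain of `J`.
-/

namespace GLS

section IntegralRadical

theorem comap_radical_map_of_isIntegral {R S : Type*} [CommRing R] [CommRing S] {f : R →+* S}
    (hf : f.IsIntegral) (hinj : Function.Injective f) (I : Ideal R) :
    (I.map f).radical.comap f = I.radical := by
  refine le_antisymm ?_ (Ideal.map_le_iff_le_comap.1 (Ideal.map_radical_le f))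
  rw [I.radical_eq_sInf]
  refine le_sInf fun p ⟨hIp, hp⟩ => ?_
  algebraize [f]
  obtain ⟨q, -, hq, hqp⟩ := Ideal.exists_ideal_over_prime_of_isIntegral (S := S) p ⊥
    (((RingHom.injective_iff_ker_eq_bot f).1 hinj).trans_le bot_le)
  have hIq : (I.map f).radical ≤ q :=
    hq.radical_le_iff.2 (Ideal.map_le_iff_le_comap.2 (hqp ▸ hIp))
  exact (Ideal.comap_mono hIq).trans_eq hqp

variable {A Q : Type*} [CommRing A] [CommRing Q] [Algebra A Q]

variable (Q) in
/-- The radical of the extension of `I` to the integral closure `Ā` of `A` in `Q`, viewed inside `Q`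
so that it can be intersected with the subalgebras of `Q`. It consists of the roots in `Q` of the
monic polynomials whose lower coefficients all lie in `I`. -/
def integralRadical (I : Ideal A) : Submodule A Q :=
  ((I.map (algebraMap A (integralClosure A Q))).radical.restrictScalars A).map
    (integralClosure A Q).val.toLinearMap

theorem mem_integralRadical_iff {I : Ideal A} {x : Q} (hx : x ∈ integralClosure A Q) :
    x ∈ integralRadical Q I ↔
      (⟨x, hx⟩ : integralClosure A Q) ∈ (I.map (algebraMap A (integralClosure A Q))).radical :=
  ⟨fun ⟨_, hy, hyx⟩ => (Subtype.ext hyx : _ = (⟨x, hx⟩ : integralClosure A Q)) ▸ hy,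
    fun h => ⟨_, h, rfl⟩⟩

theorem integralRadical_le_integralClosure (I : Ideal A) :
    integralRadical Q I ≤ Subalgebra.toSubmodule (integralClosure A Q) := by
  rintro _ ⟨y, -, rfl⟩
  exact y.2

theorem mul_mem_integralRadical {I : Ideal A} {x y : Q} (hx : x ∈ integralClosure A Q)
    (hy : y ∈ integralRadical Q I) : x * y ∈ integralRadical Q I := by
  have hyB := integralRadical_le_integralClosure I hy
  exact (mem_integralRadical_iff (mul_mem hx hyB)).2
    (Ideal.mul_mem_left _ ⟨x, hx⟩ ((mem_integralRadical_iff hyB).1 hy))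

theorem mem_radical_map_iff_mem_integralRadical {C : Subalgebra A Q}
    (hC : C ≤ integralClosure A Q) {I : Ideal A} (y : C) :
    y ∈ (I.map (algebraMap A C)).radical ↔ (y : Q) ∈ integralRadical Q I := by
  let f : C →+* integralClosure A Q := (Subalgebra.inclusion hC).toRingHom
  have hcomp : f.comp (algebraMap A C) = algebraMap A (integralClosure A Q) :=
    (Subalgebra.inclusion hC).comp_algebraMap
  have hf : f.IsIntegral := RingHom.IsIntegral.tower_top (algebraMap A C) f <| by
    rw [hcomp]
    exact fun b => Algebra.IsIntegral.isIntegral b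
  rw [mem_integralRadical_iff (hC y.2),
    ← comap_radical_map_of_isIntegral hf (Subalgebra.inclusion_injective hC),
    Ideal.map_map, hcomp]
  rfl

end IntegralRadical

section EndSubalgebra

variable {A Q : Type*} [CommRing A] [CommRing Q] [Algebra A Q]

theorem mem_endSubalgebra_iff {C : Subalgebra A Q} {J : Ideal C} {x : Q} :
    x ∈ endSubalgebra C J ↔ ∀ y ∈ J, ∃ z ∈ J, (z : Q) = x * (y : Q) := by
  constructor
  · rintro ⟨φ, hφ⟩ y hy
    exact ⟨φ ⟨y, hy⟩, (φ ⟨y, hy⟩).2, hφ ⟨y, hy⟩⟩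
  · intro h
    choose f hf hfx using h
    refine ⟨⟨⟨fun y => ⟨f y y.2, hf y y.2⟩, fun y z => ?_⟩, fun c y => ?_⟩, fun y => hfx y y.2⟩
    · ext
      simp [hfx, mul_add]
    · ext
      simp [hfx, mul_left_comm]

theorem le_endSubalgebra (C : Subalgebra A Q) (J : Ideal C) : C ≤ endSubalgebra C J :=
  fun x hx => mem_endSubalgebra_iff.2 fun y hy => ⟨⟨x, hx⟩ * y, J.mul_mem_left _ hy, rfl⟩

theorem endSubalgebra_top (C : Subalgebra A Q) : endSubalgebra C (⊤ : Ideal C) = C := by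
  refine le_antisymm (fun x hx => ?_) (le_endSubalgebra C ⊤)
  obtain ⟨z, -, hz⟩ := mem_endSubalgebra_iff.1 hx 1 trivial
  rw [OneMemClass.coe_one, mul_one] at hz
  exact hz ▸ z.2

theorem mem_endSubalgebra_radical_iff {C : Subalgebra A Q} (hC : C ≤ integralClosure A Q)
    {I : Ideal A} {x : Q} (hx : x ∈ integralClosure A Q) :
    x ∈ endSubalgebra C (I.map (algebraMap A C)).radical ↔
      ∀ y ∈ Subalgebra.toSubmodule C ⊓ integralRadical Q I, x * y ∈ C := by
  simp only [mem_endSubalgebra_iff, mem_radical_map_iff_mem_integralRadical hC]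
  constructor
  · rintro h y ⟨hyC, hyI⟩
    obtain ⟨z, -, hz⟩ := h ⟨y, hyC⟩ hyI
    exact hz ▸ z.2
  · exact fun h y hy => ⟨⟨_, h y ⟨y.2, hy⟩⟩, mul_mem_integralRadical hx hy, rfl⟩

theorem isNoetherian_of_isUnit_mul_mem {M N : Submodule A Q} [IsNoetherian A N] {u : Q}
    (hu : IsUnit u) (h : ∀ x ∈ M, u * x ∈ N) : IsNoetherian A M :=
  isNoetherian_of_injective ((LinearMap.mulLeft A u).restrict h) fun _ _ hxy =>
    Subtype.ext (hu.mul_left_cancel (congrArg Subtype.val hxy))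

theorem isNoetherian_endSubalgebra {C : Subalgebra A Q} [IsNoetherian A C] {J : Ideal C} {u : C}
    (hu : IsUnit (u : Q)) (huJ : u ∈ J) : IsNoetherian A (endSubalgebra C J) := by
  have : IsNoetherian A (Subalgebra.toSubmodule C) := ‹IsNoetherian A C›
  refine isNoetherian_of_isUnit_mul_mem (M := Subalgebra.toSubmodule (endSubalgebra C J))
    (N := Subalgebra.toSubmodule C) hu fun x hx => ?_
  obtain ⟨z, -, hz⟩ := mem_endSubalgebra_iff.1 hx u huJ
  rw [mul_comm, ← hz]
  exact z.2

end EndSubalgebra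

section LEAt

/-- The submodule `M` is contained in `N` near `P`: a single element outside `P` multiplies all of
`M` into `N`. If `M` is finitely generated, this says that `M_P ⊆ N_P`; asking for one multiplier
for all of `M` makes finite generation irrelevant in the comparison of the chains. -/
def LEAt {A E : Type*} [CommRing A] [AddCommGroup E] [Module A E] (P : Ideal A)
    (M N : Submodule A E) : Prop :=
  ∃ s ∉ P, ∀ x ∈ M, s • x ∈ N

namespace LEAt

variable {A : Type*} [CommRing A] {P : Ideal A}

section Module

variable {E : Type*} [AddCommGroup E] [Module A E] {M N L : Submodule A E} [P.IsPrime]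

theorem of_le (h : M ≤ N) : LEAt P M N :=
  ⟨1, Ideal.one_notMem P, fun x hx => (one_smul A x).symm ▸ h hx⟩

theorem trans : LEAt P M N → LEAt P N L → LEAt P M L := by
  rintro ⟨s, hs, hMN⟩ ⟨t, ht, hNL⟩
  exact ⟨t * s, P.primeCompl.mul_mem ht hs, fun x hx => mul_smul t s x ▸ hNL _ (hMN x hx)⟩

theorem inf {M' N' : Submodule A E} : LEAt P M N → LEAt P M' N' → LEAt P (M ⊓ M') (N ⊓ N') := by
  rintro ⟨s, hs, h⟩ ⟨t, ht, h'⟩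
  refine ⟨s * t, P.primeCompl.mul_mem hs ht, fun x hx => ⟨?_, ?_⟩⟩
  · rw [mul_comm, mul_smul]
    exact N.smul_mem t (h x hx.1)
  · rw [mul_smul]
    exact N'.smul_mem s (h' x hx.2)

end Module

variable {Q : Type*} [CommRing Q] [Algebra A Q] {I J : Ideal A}

theorem integralRadical : LEAt P I J.radical →
    LEAt P (integralRadical Q I) (integralRadical Q J) := by
  rintro ⟨t, ht, htIJ⟩
  refine ⟨t, ht, fun x hx => ?_⟩
  let B := integralClosure A Q
  let R : Ideal B := (J.map (algebraMap A B)).radical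
  let τ : B := algebraMap A B t
  have hxB : x ∈ B := integralRadical_le_integralClosure I hx
  have hIR : I.map (algebraMap A B) ≤ R.colon {τ} := by
    refine Ideal.map_le_iff_le_comap.2 fun a ha => ?_
    rw [Ideal.mem_comap, Submodule.mem_colon_singleton, smul_eq_mul, ← map_mul, mul_comm]
    exact Ideal.map_radical_le _ (Ideal.mem_map_of_mem _ (htIJ a ha))
  obtain ⟨k, hk⟩ := (mem_integralRadical_iff hxB).1 hx
  have hτk : (⟨x, hxB⟩ : B) ^ k * τ ∈ R := Submodule.mem_colon_singleton.1 (hIR hk)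
  refine (mem_integralRadical_iff (B.smul_mem hxB t)).2 (Ideal.radical_isRadical _ ⟨k + 1, ?_⟩)
  have : (⟨t • x, B.smul_mem hxB t⟩ : B) ^ (k + 1) = τ ^ k * ⟨x, hxB⟩ * (⟨x, hxB⟩ ^ k * τ) := by
    rw [show (⟨t • x, _⟩ : B) = τ * ⟨x, hxB⟩ from Subtype.ext (Algebra.smul_def t x)]
    ring
  exact this ▸ R.mul_mem_left _ hτk

theorem endSubalgebra [P.IsPrime] {C D : Subalgebra A Q} (hC : C ≤ integralClosure A Q)
    (hD : D ≤ integralClosure A Q)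
    (hEnd : endSubalgebra C (I.map (algebraMap A C)).radical ≤ integralClosure A Q)
    (hCD : LEAt P (Subalgebra.toSubmodule C) (Subalgebra.toSubmodule D))
    (hDC : LEAt P (Subalgebra.toSubmodule D) (Subalgebra.toSubmodule C))
    (hJI : LEAt P J I.radical) :
    LEAt P (Subalgebra.toSubmodule (endSubalgebra C (I.map (algebraMap A C)).radical))
      (Subalgebra.toSubmodule (endSubalgebra D (J.map (algebraMap A D)).radical)) := by
  obtain ⟨s, hs, hsCD⟩ := hCD
  obtain ⟨t, ht, htDC⟩ := hDC.inf (hJI.integralRadical (Q := Q))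
  refine ⟨s * t, P.primeCompl.mul_mem hs ht, fun x hx => ?_⟩
  have hxB := hEnd hx
  refine (mem_endSubalgebra_radical_iff hD (Subalgebra.smul_mem _ hxB _)).2 fun y hy => ?_
  have hxty : x * (t • y) ∈ C := (mem_endSubalgebra_radical_iff hC hxB).1 hx _ (htDC y hy)
  rw [smul_mul_assoc, mul_smul, ← mul_smul_comm]
  exact hsCD _ hxty

end LEAt

theorem leAt_radical_of_mem_minimalPrimes {A : Type*} [CommRing A] {J P : Ideal A}
    (hfin : J.minimalPrimes.Finite) (hP : P ∈ J.minimalPrimes) : LEAt P P J.radical := by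
  classical
  have hPprime : P.IsPrime := hP.isPrime
  let T : Finset (Ideal A) := hfin.toFinset.erase P
  have hT : ¬ T.inf id ≤ P := by
    rw [hPprime.inf_le']
    rintro ⟨q, hqT, hqP⟩
    obtain ⟨hne, hq⟩ := Finset.mem_erase.1 hqT
    exact hne (hqP.antisymm (hP.2 (hfin.mem_toFinset.1 hq).1 hqP))
  obtain ⟨t, htT, htP⟩ := SetLike.not_le_iff_exists.1 hT
  refine ⟨t, htP, fun a ha => ?_⟩
  rw [← J.sInf_minimalPrimes, smul_eq_mul, Ideal.mem_sInf]
  intro q hq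
  by_cases hqP : q = P
  · exact hqP ▸ P.mul_mem_left t ha
  · have hqT : q ∈ T := Finset.mem_erase.2 ⟨hqP, hfin.mem_toFinset.2 hq⟩
    exact q.mul_mem_right a (Finset.inf_le (f := id) hqT htT)

end LEAt

section Chain

variable {A : Type*} [CommRing A]

theorem chain_mono (J : Ideal A) : Monotone (chain J) :=
  monotone_nat_of_le_succ fun _ => le_endSubalgebra _ _

theorem chain_top (i : ℕ) : chain (⊤ : Ideal A) i = ⊥ := by
  induction i with
  | zero => rfl
  | succ i ih => rw [chain, Ideal.map_top, Ideal.radical_top, endSubalgebra_top, ih]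

variable [IsNoetherianRing A]

theorem isNoetherian_chain {J : Ideal A} (hJ : ∃ g ∈ J, g ∈ nonZeroDivisors A) (i : ℕ) :
    IsNoetherian A (chain J i) := by
  obtain ⟨g, hgJ, hg⟩ := hJ
  induction i with
  | zero => exact isNoetherian_of_isNoetherianRing_of_finite A (⊥ : Subalgebra A (FractionRing A))
  | succ i ih =>
    exact isNoetherian_endSubalgebra (u := algebraMap A (chain J i) g)
      (IsLocalization.map_units (FractionRing A) (⟨g, hg⟩ : nonZeroDivisors A))
      (Ideal.le_radical (Ideal.mem_map_of_mem _ hgJ))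

theorem chain_le_integralClosure {J : Ideal A} (hJ : ∃ g ∈ J, g ∈ nonZeroDivisors A) (i : ℕ) :
    chain J i ≤ integralClosure A (FractionRing A) := by
  have := isNoetherian_chain hJ i
  exact fun x hx => (Algebra.IsIntegral.isIntegral (R := A) (⟨x, hx⟩ : chain J i)).map
    (chain J i).val

theorem exists_chain_eq_succ [Module.Finite A (integralClosure A (FractionRing A))] {J : Ideal A}
    (hJ : ∃ g ∈ J, g ∈ nonZeroDivisors A) : ∃ n, chain J n = chain J (n + 1) := by
  let B := integralClosure A (FractionRing A)
  let traceOnB : ℕ →o Submodule A B :=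
    ⟨fun i => (Subalgebra.toSubmodule (chain J i)).comap B.val.toLinearMap,
      fun _ _ hij => Submodule.comap_mono (chain_mono J hij)⟩
  obtain ⟨n, hn⟩ := monotone_stabilizes_iff_noetherian.2
    (isNoetherian_of_isNoetherianRing_of_finite A B) traceOnB
  refine ⟨n, le_antisymm (chain_mono J n.le_succ) fun x hx => ?_⟩
  have hxB : (⟨x, chain_le_integralClosure hJ _ hx⟩ : B) ∈ traceOnB (n + 1) := hx
  exact (hn (n + 1) n.le_succ).ge hxB

theorem numSteps_lt_top [Module.Finite A (integralClosure A (FractionRing A))] {J : Ideal A}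
    (hJ : ∃ g ∈ J, g ∈ nonZeroDivisors A) : numSteps J < ⊤ := by
  obtain ⟨n, hn⟩ := exists_chain_eq_succ hJ
  exact (iInf₂_le n hn).trans_lt (ENat.natCast_lt_top n)

variable {I J : Ideal A} {P : Ideal A} [P.IsPrime]

theorem LEAt.chain (hI : ∃ g ∈ I, g ∈ nonZeroDivisors A) (hJ : ∃ g ∈ J, g ∈ nonZeroDivisors A)
    (hIJ : LEAt P I J.radical) (hJI : LEAt P J I.radical) (i : ℕ) :
    LEAt P (Subalgebra.toSubmodule (chain I i)) (Subalgebra.toSubmodule (chain J i)) ∧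
      LEAt P (Subalgebra.toSubmodule (chain J i)) (Subalgebra.toSubmodule (chain I i)) := by
  have hI' := chain_le_integralClosure hI
  have hJ' := chain_le_integralClosure hJ
  induction i with
  | zero => exact ⟨.of_le le_rfl, .of_le le_rfl⟩
  | succ i ih =>
    exact ⟨.endSubalgebra (hI' i) (hJ' i) (hI' (i + 1)) ih.1 ih.2 hJI,
      .endSubalgebra (hJ' i) (hI' i) (hJ' (i + 1)) ih.2 ih.1 hIJ⟩

theorem LEAt.chain_succ_of_chain_eq_succ (hI : ∃ g ∈ I, g ∈ nonZeroDivisors A)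
    (hJ : ∃ g ∈ J, g ∈ nonZeroDivisors A) (hIJ : LEAt P I J.radical) (hJI : LEAt P J I.radical)
    {n : ℕ} (hn : GLS.chain J n = GLS.chain J (n + 1)) :
    LEAt P (Subalgebra.toSubmodule (GLS.chain I (n + 1)))
      (Subalgebra.toSubmodule (GLS.chain I n)) :=
  (LEAt.chain hI hJ hIJ hJI (n + 1)).1.trans (hn ▸ (LEAt.chain hI hJ hIJ hJI n).2)

end Chain

section SerreS

theorem dvd_of_isWeaklyRegular_pair {R : Type*} [CommRing R] {r₁ r₂ s b : R}
    (hr : RingTheory.Sequence.IsWeaklyRegular R [r₁, r₂]) (hs : s ∈ nonZeroDivisors R)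
    (h₁ : s ∣ r₁ * b) (h₂ : s ∣ r₂ * b) : s ∣ b := by
  rw [RingTheory.Sequence.isWeaklyRegular_cons_iff,
    RingTheory.Sequence.isWeaklyRegular_singleton_iff] at hr
  obtain ⟨hr₁, hr₂⟩ := hr
  obtain ⟨c, hc⟩ := h₁
  obtain ⟨d, hd⟩ := h₂
  have hcd : r₂ * c = r₁ * d := by
    refine (mul_cancel_left_mem_nonZeroDivisors hs).1 ?_
    linear_combination r₁ * hd - r₂ * hc
  obtain ⟨e, rfl⟩ : r₁ ∣ c := by
    have hc₀ : (Submodule.Quotient.mk c : QuotSMulTop r₁ R) = 0 := by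
      refine hr₂ ?_
      simp only [smul_zero]
      rw [← Submodule.Quotient.mk_smul, Submodule.Quotient.mk_eq_zero, smul_eq_mul, hcd]
      exact Submodule.smul_mem_pointwise_smul d r₁ ⊤ trivial
    obtain ⟨e, -, he⟩ := (Submodule.Quotient.mk_eq_zero _).1 hc₀
    exact ⟨e, he.symm⟩
  exact ⟨e, hr₁ (show r₁ * b = r₁ * (s * e) by linear_combination hc)⟩

theorem depth_le_one_of_forall_dvd_mul {R : Type*} [CommRing R] [IsLocalRing R] {s b : R}
    (hs : s ∈ nonZeroDivisors R) (hb : ¬ s ∣ b)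
    (h : ∀ r ∈ IsLocalRing.maximalIdeal R, s ∣ r * b) : depth R ≤ 1 := by
  refine iSup₂_le fun rs ⟨hmem, hreg⟩ => ?_
  match rs, hmem, hreg with
  | [], _, _ => simp
  | [_], _, _ => simp
  | r₁ :: r₂ :: rs, hmem, hreg =>
    have hpair : RingTheory.Sequence.IsWeaklyRegular R [r₁, r₂] :=
      ((RingTheory.Sequence.isWeaklyRegular_append_iff R [r₁, r₂] rs).1 hreg.toIsWeaklyRegular).1
    exact (hb (dvd_of_isWeaklyRegular_pair hpair hs (h r₁ (hmem r₁ (by simp)))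
      (h r₂ (hmem r₂ (by simp))))).elim

theorem mk'_mem_bot_iff_dvd {A K : Type*} [CommRing A] [CommRing K] [Algebra A K]
    [IsFractionRing A K] {a : A} {s : nonZeroDivisors A} :
    IsLocalization.mk' K a s ∈ (⊥ : Subalgebra A K) ↔ (s : A) ∣ a := by
  rw [Algebra.mem_bot]
  constructor
  · rintro ⟨c, hc⟩
    rw [IsLocalization.eq_mk'_iff_mul_eq, ← map_mul] at hc
    exact ⟨c, (IsFractionRing.injective A K hc).symm.trans (mul_comm _ _)⟩
  · rintro ⟨c, hc⟩
    exact ⟨c, by rw [hc, IsLocalization.mk'_mul_cancel_left]⟩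

variable {A : Type*} [CommRing A]

theorem mem_colon_mk_iff_dvd_mul {s b r : A} :
    r ∈ (⊥ : Submodule A (A ⧸ Ideal.span {s})).colon {Submodule.Quotient.mk b} ↔ s ∣ r * b := by
  rw [Submodule.mem_colon_singleton, ← Submodule.Quotient.mk_smul, Submodule.mem_bot,
    Submodule.Quotient.mk_eq_zero, smul_eq_mul, Ideal.mem_span_singleton]

variable [IsNoetherianRing A]

theorem depth_atPrime_le_one_of_mem_associatedPrimes {s : A} (hs : s ∈ nonZeroDivisors A)
    {P : Ideal A} [P.IsPrime] (hP : P ∈ associatedPrimes A (A ⧸ Ideal.span {s})) :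
    depth (Localization.AtPrime P) ≤ 1 := by
  obtain ⟨-, b, hPb⟩ := isAssociatedPrime_iff.1 hP
  obtain ⟨b, rfl⟩ := Submodule.Quotient.mk_surjective _ b
  have hP (r : A) : r ∈ P ↔ s ∣ r * b := by
    conv_lhs => rw [hPb]
    exact mem_colon_mk_iff_dvd_mul
  let φ := algebraMap A (Localization.AtPrime P)
  refine depth_le_one_of_forall_dvd_mul (s := φ s) (b := φ b)
    (IsLocalization.map_nonZeroDivisors_le P.primeCompl _ (Submonoid.mem_map_of_mem _ hs)) ?_ ?_
  · intro hdvd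
    rw [← Ideal.mem_span_singleton, ← Set.image_singleton, ← Ideal.map_span,
      IsLocalization.algebraMap_mem_map_algebraMap_iff P.primeCompl] at hdvd
    obtain ⟨u, huP, hu⟩ := hdvd
    exact huP ((hP u).2 (Ideal.mem_span_singleton.1 hu))
  · have hle : (IsLocalRing.maximalIdeal (Localization.AtPrime P)) ≤
        (Ideal.span {φ s}).colon {φ b} := by
      rw [← Localization.AtPrime.map_eq_maximalIdeal, Ideal.map_le_iff_le_comap]
      intro r hr
      rw [Ideal.mem_comap, Submodule.mem_colon_singleton, smul_eq_mul, ← map_mul,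
        Ideal.mem_span_singleton]
      exact map_dvd φ ((hP r).1 hr)
    exact fun r hr => Ideal.mem_span_singleton.1 (Submodule.mem_colon_singleton.1 (hle hr))

theorem SerreS.height_le_one_of_mem_associatedPrimes (hS2 : SerreS A 2) {s : A}
    (hs : s ∈ nonZeroDivisors A) {P : Ideal A}
    (hP : P ∈ associatedPrimes A (A ⧸ Ideal.span {s})) : P.height ≤ 1 := by
  have := hP.isPrime
  have h := hS2 P
  rw [IsLocalization.AtPrime.ringKrullDim_eq_height P (Localization.AtPrime P)] at h
  have hmin : min (2 : ℕ∞) P.height ≤ 1 :=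
    (WithBot.coe_le_coe.1 ((WithBot.coe_min _ _).trans_le h)).trans
      (depth_atPrime_le_one_of_mem_associatedPrimes hs hP)
  exact (min_le_iff.1 hmin).resolve_left (by decide)

theorem SerreS.mem_bot_of_forall_height_le_one (hS2 : SerreS A 2) {x : FractionRing A}
    (h : ∀ (P : Ideal A) [P.IsPrime], P.height ≤ 1 →
      ∃ s ∉ P, s • x ∈ (⊥ : Subalgebra A (FractionRing A))) :
    x ∈ (⊥ : Subalgebra A (FractionRing A)) := by
  obtain ⟨a, s, rfl⟩ := IsLocalization.exists_mk'_eq (nonZeroDivisors A) x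
  simp only [IsLocalization.smul_mk', mk'_mem_bot_iff_dvd] at h ⊢
  by_contra hsa
  have ha : (Submodule.Quotient.mk a : A ⧸ Ideal.span {(s : A)}) ≠ 0 := by
    rwa [Ne, Submodule.Quotient.mk_eq_zero, Ideal.mem_span_singleton]
  obtain ⟨P, hP, hcolon⟩ := exists_le_isAssociatedPrime_of_isNoetherianRing A _ ha
  have := hP.isPrime
  obtain ⟨r, hrP, hr⟩ := h P (hS2.height_le_one_of_mem_associatedPrimes s.2 hP)
  exact hrP (hcolon (mem_colon_mk_iff_dvd_mul.2 hr))

theorem SerreS.mem_chain_of_forall_height_le_one (hS2 : SerreS A 2) {J : Ideal A}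
    (hJ : ∃ g ∈ J, g ∈ nonZeroDivisors A) (i : ℕ) {x : FractionRing A}
    (hx : x ∈ integralClosure A (FractionRing A))
    (h : ∀ (P : Ideal A) [P.IsPrime], P.height ≤ 1 → ∃ s ∉ P, s • x ∈ chain J i) :
    x ∈ chain J i := by
  induction i generalizing x with
  | zero => exact hS2.mem_bot_of_forall_height_le_one h
  | succ i ih =>
    have hi := chain_le_integralClosure hJ i
    refine (mem_endSubalgebra_radical_iff hi hx).2 fun y hy => ?_
    refine ih (mul_mem hx (hi hy.1)) fun P _ hP => ?_
    obtain ⟨s, hsP, hs⟩ := h P hP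
    have hsxy := (mem_endSubalgebra_radical_iff hi (Subalgebra.smul_mem _ hx s)).1 hs y hy
    exact ⟨s, hsP, by rwa [smul_mul_assoc] at hsxy⟩

end SerreS

section Comparison

variable {A : Type*} [CommRing A]

theorem exists_mem_nonZeroDivisors_of_le_radical {I J : Ideal A}
    (hJ : ∃ g ∈ J, g ∈ nonZeroDivisors A) (hJI : J ≤ I.radical) :
    ∃ g ∈ I, g ∈ nonZeroDivisors A := by
  obtain ⟨g, hgJ, hg⟩ := hJ
  obtain ⟨k, hk⟩ := hJI hgJ
  exact ⟨g ^ k, hk, pow_mem hg k⟩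

variable [IsNoetherianRing A]

theorem mem_minimalPrimes_of_height_le_one {J : Ideal A} (hJ : ∃ g ∈ J, g ∈ nonZeroDivisors A)
    {P : Ideal A} [P.IsPrime] (hP : P.height ≤ 1) (hJP : J ≤ P) : P ∈ J.minimalPrimes := by
  obtain ⟨g, hgJ, hg⟩ := hJ
  have hJheight : 1 ≤ J.height :=
    (Ideal.one_le_height_span_singleton_of_mem_nonZeroDivisors hg).trans
      (Ideal.height_mono ((Ideal.span_singleton_le_iff_mem J).2 hgJ))
  exact Ideal.mem_minimalPrimes_of_height_le hJP (hP.trans hJheight)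

theorem leAt_chain_succ_of_le_radical {J J' : Ideal A} (hJ : ∃ g ∈ J, g ∈ nonZeroDivisors A)
    (hJJ' : J ≤ J'.radical) {n : ℕ} (hn : chain J n = chain J (n + 1)) {P : Ideal A} [P.IsPrime]
    (hP : P.height ≤ 1) :
    LEAt P (Subalgebra.toSubmodule (chain J' (n + 1))) (Subalgebra.toSubmodule (chain J' n)) := by
  have hJ' := exists_mem_nonZeroDivisors_of_le_radical hJ hJJ'
  by_cases hJP : J' ≤ P
  · have hPJ : P ∈ J.minimalPrimes := mem_minimalPrimes_of_height_le_one hJ hP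
      (hJJ'.trans (‹P.IsPrime›.radical_le_iff.2 hJP))
    have hfin := J.finite_minimalPrimes_of_isNoetherianRing A
    exact .chain_succ_of_chain_eq_succ hJ' hJ
      ((LEAt.of_le hJP).trans (leAt_radical_of_mem_minimalPrimes hfin hPJ)) (.of_le hJJ') hn
  · obtain ⟨t, htJ', htP⟩ := SetLike.not_le_iff_exists.1 hJP
    have htop : LEAt P ⊤ J'.radical :=
      ⟨t, htP, fun a _ => Ideal.le_radical (J'.mul_mem_right a htJ')⟩
    exact .chain_succ_of_chain_eq_succ (J := ⊤) hJ' ⟨1, Submodule.mem_top, one_mem _⟩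
      (.of_le (le_top.trans Ideal.le_radical)) htop (by rw [chain_top, chain_top])

theorem SerreS.numSteps_le_of_le_radical (hS2 : SerreS A 2) {J J' : Ideal A}
    (hJ : ∃ g ∈ J, g ∈ nonZeroDivisors A) (hJJ' : J ≤ J'.radical) :
    numSteps J' ≤ numSteps J := by
  have hJ' := exists_mem_nonZeroDivisors_of_le_radical hJ hJJ'
  refine le_iInf₂ fun n hn => iInf₂_le n ?_
  refine le_antisymm (chain_mono J' n.le_succ) fun x hx => ?_
  refine hS2.mem_chain_of_forall_height_le_one hJ' n (chain_le_integralClosure hJ' _ hx)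
    fun P _ hP => ?_
  obtain ⟨s, hsP, hs⟩ := leAt_chain_succ_of_le_radical hJ hJJ' hn hP
  exact ⟨s, hsP, hs x hx⟩

theorem le_radical_of_associatedPrimes_subset {J J' : Ideal A}
    (hAss : associatedPrimes A (A ⧸ J') ⊆ associatedPrimes A (A ⧸ J)) : J ≤ J'.radical := by
  have hmin : J'.minimalPrimes ⊆ associatedPrimes A (A ⧸ J') := by
    simpa [Ideal.annihilator_quotient] using
      Module.associatedPrimes.minimalPrimes_annihilator_subset_associatedPrimes A (A ⧸ J')
  rw [← J'.sInf_minimalPrimes]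
  refine le_sInf fun P hP => ?_
  simpa [Submodule.annihilator_top, Ideal.annihilator_quotient] using
    (hAss (hmin hP)).annihilator_le

end Comparison

section Conductor

variable {A : Type*} [CommRing A]

theorem IsTestIdeal.exists_mem_conductor_mem_nonZeroDivisors {J : Ideal A} (hJ : IsTestIdeal J) :
    ∃ g ∈ conductor A, g ∈ nonZeroDivisors A :=
  exists_mem_nonZeroDivisors_of_le_radical hJ.exists_nonZeroDivisor
    ((PrimeSpectrum.zeroLocus_subset_zeroLocus_iff _ _).1 hJ.zeroLocus_subset)

theorem smul_mem_bot_of_mem_conductor {g : A} (hg : g ∈ conductor A) {x : FractionRing A}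
    (hx : x ∈ integralClosure A (FractionRing A)) :
    g • x ∈ (⊥ : Subalgebra A (FractionRing A)) := by
  have h := Module.mem_annihilator.1 hg (Submodule.Quotient.mk ⟨x, hx⟩)
  rw [← Submodule.Quotient.mk_smul, Submodule.Quotient.mk_eq_zero] at h
  obtain ⟨a, ha⟩ := h
  exact Algebra.mem_bot.2 ⟨a, congrArg Subtype.val ha⟩

theorem finite_integralClosure_of_mem_conductor [IsNoetherianRing A]
    (h : ∃ g ∈ conductor A, g ∈ nonZeroDivisors A) :
    Module.Finite A (integralClosure A (FractionRing A)) := by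
  obtain ⟨g, hgC, hg⟩ := h
  let A₀ : Subalgebra A (FractionRing A) := ⊥
  have : IsNoetherian A (Subalgebra.toSubmodule A₀) :=
    isNoetherian_of_isNoetherianRing_of_finite A A₀
  have : IsNoetherian A (Subalgebra.toSubmodule (integralClosure A (FractionRing A))) := by
    refine isNoetherian_of_isUnit_mul_mem (N := Subalgebra.toSubmodule A₀)
      (IsLocalization.map_units (FractionRing A) (⟨g, hg⟩ : nonZeroDivisors A)) fun x hx => ?_
    rw [← Algebra.smul_def]
    exact smul_mem_bot_of_mem_conductor hgC hx
  exact Module.IsNoetherian.finite A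
    (Subalgebra.toSubmodule (integralClosure A (FractionRing A)))

end Conductor

end GLS

theorem mainTheorem3_general {A : Type*} [CommRing A] [IsNoetherianRing A]
    (hS2 : GLS.SerreS A 2) {J J' : Ideal A} (hJ : ∃ g ∈ J, g ∈ nonZeroDivisors A)
    (hJJ' : J ≤ J'.radical) :
    GLS.numSteps J' ≤ GLS.numSteps J ∧
      (Module.Finite A (integralClosure A (FractionRing A)) → GLS.numSteps J < ⊤) :=
  ⟨hS2.numSteps_le_of_le_radical hJ hJJ', fun _ => GLS.numSteps_lt_top hJ⟩

theorem mainTheorem3 {A : Type*} [CommRing A] [IsNoetherianRing A] [IsReduced A]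
    (hdim : GLS.IsEquidimensional A) (hS2 : GLS.SerreS A 2)
    (J : Ideal A) (hJ : GLS.IsTestIdeal J)
    (J' : Ideal A) (hJ' : J'.IsRadical)
    (hAss : associatedPrimes A (A ⧸ J') ⊆ associatedPrimes A (A ⧸ J)) :
    GLS.numSteps J' ≤ GLS.numSteps J ∧ GLS.numSteps J < ⊤ :=
  have hfin := GLS.finite_integralClosure_of_mem_conductor
    hJ.exists_mem_conductor_mem_nonZeroDivisors
  (mainTheorem3_general hS2 hJ.exists_nonZeroDivisor
    (GLS.le_radical_of_associatedPrimes_subset hAss)).imp_right fun h => h hfin
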